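/- Conventions. Let $X$ be a uniform space with basepoint $*$. Entourages are taken symmetric. For an entourage $E$, an $E$-chain is a finite sequence $\{x_0=*,x_1,\dots,x_n\}$ with $(x_i,x_{i+1})\in E$ for all $i$; two $E$-chains are $E$-homotopic if one is obtained from the other by finitely many moves, each adding or removing one point so that the result is again an $E$-chain with the same first and last points (in particular $\{*\}$ and $\{*,*\}$ are $E$-homotopic). Let $X_E$ be the set of $E$-homotopy classes $[\alpha]_E$ of $E$-chains starting at $*$, with the uniformity having as a basis the sets $$F^*=\{([x_0,\dots,x_{n-1},x]_E,\,[x_0,\dots,x_{n-1},y]_E) : (x,y)\in F\},$$ where $F\subset E$ ranges over entourages of $X$ and $\{x_0=*,\dots,x_{n-1},x\}$, $\{x_0=*,\dots,x_{n-1},y\}$ over $E$-chains ($n\ge 1$). Let $\phi_{XE}:X_E\to X$ be the endpoint map. For $F\subset E$ let $\phi_{EF}:X_F\to X_E$, $[\alpha]_F\mapsto[\alpha]_E$; let $\widetilde X=\varprojlim X_E$ be the inverse limit of the system $(X_E,\phi_{EF})$ over all entourages, with projections $\phi_E:\widetilde X\to X_E$ and endpoint map $\phi=\phi_{XE}\circ\phi_E:\widetilde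 X\to X$. The space $X$ is called universal if its uniformity has a basis of entourages $E$ for which $\phi_{XE}:X_E\to X$ is a uniform homeomorphism. It is called coverable if $\phi:\widetilde X\to X$ is surjective and the uniformity of $X$ has a basis of entourages $E$ for which $\phi_E:\widetilde X\to X_E$ is surjective. A map $f:X\to Y$ of uniform spaces is bi-uniformly continuous if the inverse image under $f\times f$ of every entourage of $Y$ is an entourage of $X$ and the image under $f\times f$ of every entourage of $X$ is an entourage of the subspace $f(X)$ of $Y$. Theorem. Let $X$ and $Y$ be uniform spaces and let $f:X\to Y$ be a bi-uniformly continuous surjection. If $X$ is universal with respect to some basepoint, then $Y$ is coverable with respect to every choice of basepoint in $Y$. -/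

import Mathlib

open scoped Uniformity

namespace UniformCover

/-- A symmetric entourage of a uniform space. -/
@[ext]
structure Entourage (X : Type*) [UniformSpace X] where
  carrier : Set (X × X)
  mem_uniformity : carrier ∈ 𝓤 X
  symm : ∀ {x y : X}, (x, y) ∈ carrier → (y, x) ∈ carrier

namespace Entourage

variable {X : Type*} [UniformSpace X]

/-- The entourage `X × X`. -/
def full : Entourage X where
  carrier := Set.univ
  mem_uniformity := Filter.univ_mem
  symm := fun _ => trivial

/-- The intersection of two entourages. -/
def inter (E F : Entourage X) : Entourage X where
  carrier := E.carrier ∩ F.carrier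
  mem_uniformity := Filter.inter_mem E.mem_uniformity F.mem_uniformity
  symm := fun h => ⟨E.symm h.1, F.symm h.2⟩

theorem refl (E : Entourage X) (x : X) : (x, x) ∈ E.carrier :=
  refl_mem_uniformity E.mem_uniformity

/-- Inside the intersection of two entourages there is a composition square `F ∘ F`. -/
theorem exists_comp (E G : Entourage X) :
    ∃ F : Entourage X, F.carrier ⊆ E.carrier ∧
      ∀ x y z, (x, y) ∈ F.carrier → (y, z) ∈ F.carrier → (x, z) ∈ G.carrier := by
  obtain ⟨t, ht, hsymm, htG⟩ := comp_symm_mem_uniformity_sets G.mem_uniformity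
  refine ⟨⟨E.carrier ∩ t, Filter.inter_mem E.mem_uniformity ht,
    fun h => ⟨E.symm h.1, hsymm.symm _ _ h.2⟩⟩, Set.inter_subset_left, ?_⟩
  intro x y z hxy hyz
  exact htG ⟨y, hxy.2, hyz.2⟩

end Entourage

section Chains

variable {X : Type*} [UniformSpace X]

/-- An `E`-chain `{x₀, x₁, …, xₙ}` (`n ≥ 0`) starting at the basepoint `x₀`;
`tail` is the list `x₁, …, xₙ`. -/
structure Chain (E : Entourage X) (x₀ : X) where
  tail : List X
  isChain : List.IsChain (fun a b => (a, b) ∈ E.carrier) (x₀ :: tail)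

namespace Chain

variable {E F : Entourage X} {x₀ : X}

/-- The list of all points of the chain, including the basepoint. -/
def points (α : Chain E x₀) : List X := x₀ :: α.tail

/-- The last point of a chain. -/
def endpoint (α : Chain E x₀) : X := α.points.getLast (List.cons_ne_nil _ _)

/-- The chain `{x₀, …, xₙ, x}`. -/
def snoc (α : Chain E x₀) (x : X) (h : (α.endpoint, x) ∈ E.carrier) : Chain E x₀ where
  tail := α.tail ++ [x]
  isChain := by
    rw [← List.cons_append, List.isChain_append]
    refine ⟨α.isChain, List.isChain_singleton _, ?_⟩
    intro a ha b hb
    rw [List.getLast?_eq_getLast_of_ne_nil (List.cons_ne_nil _ _)] at ha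
    simp only [List.head?_cons, Option.mem_def, Option.some.injEq] at ha hb
    subst ha hb
    exact h

/-- An `F`-chain considered as an `E`-chain, when `F ⊆ E`. -/
def ofLE (h : F.carrier ⊆ E.carrier) (α : Chain F x₀) : Chain E x₀ where
  tail := α.tail
  isChain := α.isChain.imp (fun _ _ hab => h hab)

/-- `β` arises from `α` by adding one point, the endpoints being kept
(both chains start at `x₀`). In particular `{x₀}` and `{x₀, x₀}` are related. -/
def AddPoint (α β : Chain E x₀) : Prop :=
  (∃ (u v : List X) (a : X), α.points = u ++ v ∧ β.points = u ++ a :: v) ∧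
    α.endpoint = β.endpoint

/-- `E`-homotopy of chains: finitely many moves, each adding or removing one point. -/
def Homotopic (α β : Chain E x₀) : Prop := Relation.EqvGen AddPoint α β

theorem Homotopic.endpoint_eq {α β : Chain E x₀} (h : Homotopic α β) :
    α.endpoint = β.endpoint := by
  induction h with
  | rel _ _ h => exact h.2
  | refl _ => rfl
  | symm _ _ _ ih => exact ih.symm
  | trans _ _ _ _ _ ih₁ ih₂ => exact ih₁.trans ih₂

theorem Homotopic.ofLE (h : F.carrier ⊆ E.carrier) {α β : Chain F x₀} (hαβ : Homotopic α β) :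
    Homotopic (α.ofLE h) (β.ofLE h) := by
  induction hαβ with
  | rel _ _ h => exact .rel _ _ h
  | refl _ => exact .refl _
  | symm _ _ _ ih => exact .symm _ _ ih
  | trans _ _ _ _ _ ih₁ ih₂ => exact .trans _ _ _ ih₁ ih₂

@[simp]
theorem endpoint_snoc (α : Chain E x₀) (x : X) (h : (α.endpoint, x) ∈ E.carrier) :
    (α.snoc x h).endpoint = x := by
  simp [endpoint, points, snoc]

theorem points_snoc (α : Chain E x₀) (x : X) (h : (α.endpoint, x) ∈ E.carrier) :
    (α.snoc x h).points = α.points ++ [x] := rfl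

theorem Homotopic.snoc {α β : Chain E x₀} (h : Homotopic α β) (x : X)
    (hα : (α.endpoint, x) ∈ E.carrier) (hβ : (β.endpoint, x) ∈ E.carrier) :
    Homotopic (α.snoc x hα) (β.snoc x hβ) := by
  induction h with
  | rel α β h =>
    obtain ⟨⟨u, v, a, h₁, h₂⟩, -⟩ := h
    refine .rel _ _ ⟨⟨u, v ++ [x], a, ?_, ?_⟩, by simp⟩
    · rw [points_snoc, h₁, List.append_assoc]
    · rw [points_snoc, h₂, List.append_assoc, List.cons_append]
  | refl _ => exact .refl _
  | symm α β _ ih => exact .symm _ _ (ih hβ hα)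
  | trans α β γ h₁ h₂ ih₁ ih₂ =>
    have hb : (β.endpoint, x) ∈ E.carrier := Homotopic.endpoint_eq h₂ ▸ hβ
    exact .trans _ _ _ (ih₁ hα hb) (ih₂ hb hβ)

/-- A point `y` may be inserted before the last point `x` of a chain. -/
theorem homotopic_snoc_snoc (γ : Chain E x₀) (x y : X) (hx : (γ.endpoint, x) ∈ E.carrier)
    (hy : (γ.endpoint, y) ∈ E.carrier) (hyx : ((γ.snoc y hy).endpoint, x) ∈ E.carrier) :
    Homotopic (γ.snoc x hx) ((γ.snoc y hy).snoc x hyx) := by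
  refine .rel _ _ ⟨⟨γ.points, [x], y, rfl, ?_⟩, by simp⟩
  rw [points_snoc, points_snoc, List.append_assoc]
  rfl

end Chain

/-- The relation of `E`-homotopy on `E`-chains. -/
instance chainSetoid (E : Entourage X) (x₀ : X) : Setoid (Chain E x₀) :=
  Relation.EqvGen.setoid Chain.AddPoint

/-- The space `X_E` of `E`-homotopy classes of `E`-chains starting at `x₀`. -/
def ChainSpace (E : Entourage X) (x₀ : X) : Type _ := Quotient (chainSetoid E x₀)

namespace ChainSpace

variable {E F : Entourage X} {x₀ : X}

/-- The class `[α]_E`. -/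
def mk (α : Chain E x₀) : ChainSpace E x₀ := Quotient.mk _ α

theorem mk_eq {α β : Chain E x₀} : mk α = mk β ↔ Chain.Homotopic α β := Quotient.eq

variable (E x₀) in
/-- The endpoint map `φ_{XE} : X_E → X`. -/
def endpoint : ChainSpace E x₀ → X :=
  Quotient.lift Chain.endpoint (fun _ _ h => Chain.Homotopic.endpoint_eq h)

/-- The map `φ_{EF} : X_F → X_E`, `[α]_F ↦ [α]_E`, for `F ⊆ E`. -/
def bond (h : F.carrier ⊆ E.carrier) : ChainSpace F x₀ → ChainSpace E x₀ :=
  Quotient.map (Chain.ofLE h) (fun _ _ hαβ => Chain.Homotopic.ofLE h hαβ)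

variable (E x₀) in
/-- The set `F*` of all pairs `([x₀, …, xₙ₋₁, x]_E, [x₀, …, xₙ₋₁, y]_E)` with `(x, y) ∈ F`. -/
def star (F : Entourage X) : Set (ChainSpace E x₀ × ChainSpace E x₀) :=
  {p | ∃ (γ : Chain E x₀) (x y : X) (hx : (γ.endpoint, x) ∈ E.carrier)
      (hy : (γ.endpoint, y) ∈ E.carrier), (x, y) ∈ F.carrier ∧
      p.1 = mk (γ.snoc x hx) ∧ p.2 = mk (γ.snoc y hy)}

theorem star_mono {F G : Entourage X} (h : F.carrier ⊆ G.carrier) :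
    star E x₀ F ⊆ star E x₀ G := by
  rintro p ⟨γ, x, y, hx, hy, hxy, h₁, h₂⟩
  exact ⟨γ, x, y, hx, hy, h hxy, h₁, h₂⟩

theorem star_refl (F : Entourage X) (a : ChainSpace E x₀) : (a, a) ∈ star E x₀ F := by
  induction a using Quotient.inductionOn with
  | h α =>
    have key : mk α = mk (α.snoc α.endpoint (E.refl _)) := by
      refine mk_eq.2 (.rel _ _ ⟨⟨α.points, [], α.endpoint, by simp, rfl⟩, by simp⟩)
    exact ⟨α, _, _, E.refl _, E.refl _, F.refl _, key, key⟩

theorem star_symm (F : Entourage X) {a b : ChainSpace E x₀} (h : (a, b) ∈ star E x₀ F) :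
    (b, a) ∈ star E x₀ F := by
  obtain ⟨γ, x, y, hx, hy, hxy, h₁, h₂⟩ := h
  exact ⟨γ, y, x, hy, hx, F.symm hxy, h₂, h₁⟩

theorem star_comp {F G : Entourage X} (hF : F.carrier ⊆ E.carrier)
    (hFG : ∀ x y z, (x, y) ∈ F.carrier → (y, z) ∈ F.carrier → (x, z) ∈ G.carrier)
    {a b c : ChainSpace E x₀} (hab : (a, b) ∈ star E x₀ F) (hbc : (b, c) ∈ star E x₀ F) :
    (a, c) ∈ star E x₀ G := by
  obtain ⟨γ, x, y, hx, hy, hxy, rfl, h₂⟩ := hab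
  obtain ⟨δ, y', w, hy', hw, hyw, h₃, rfl⟩ := hbc
  simp only at h₂ h₃
  have hom : Chain.Homotopic (γ.snoc y hy) (δ.snoc y' hy') := mk_eq.1 (h₂.symm.trans h₃)
  obtain rfl : y = y' := by simpa using hom.endpoint_eq
  have e₁ : ((γ.snoc y hy).endpoint, x) ∈ E.carrier := by
    simpa using E.symm (hF hxy)
  have e₂ : ((γ.snoc y hy).endpoint, w) ∈ E.carrier := by
    simpa using hF hyw
  have e₃ : ((δ.snoc y hy').endpoint, w) ∈ E.carrier := by
    simpa using hF hyw
  refine ⟨γ.snoc y hy, x, w, e₁, e₂, hFG _ _ _ hxy hyw, ?_, ?_⟩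
  · exact mk_eq.2 (Chain.homotopic_snoc_snoc γ x y hx hy e₁)
  · refine mk_eq.2 (.trans _ _ _ (Chain.homotopic_snoc_snoc δ w y hw hy' e₃) ?_)
    exact .symm _ _ (hom.snoc w e₂ e₃)

variable (E x₀) in
/-- The filter basis `{F* : F ⊆ E}`. -/
def starBasis : FilterBasis (ChainSpace E x₀ × ChainSpace E x₀) where
  sets := {S | ∃ F : Entourage X, F.carrier ⊆ E.carrier ∧ S = star E x₀ F}
  nonempty := ⟨_, E, subset_rfl, rfl⟩
  inter_sets := by
    rintro _ _ ⟨F, hF, rfl⟩ ⟨G, -, rfl⟩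
    exact ⟨_, ⟨F.inter G, Set.inter_subset_left.trans hF, rfl⟩,
      Set.subset_inter (star_mono Set.inter_subset_left) (star_mono Set.inter_subset_right)⟩

/-- The uniform structure on `X_E` with basis the sets `F*`, where `F ⊆ E`. -/
instance instUniformSpace : UniformSpace (ChainSpace E x₀) :=
  UniformSpace.ofCore <| UniformSpace.Core.mkOfBasis (starBasis E x₀)
    (by
      rintro _ ⟨F, -, rfl⟩ a
      exact star_refl F a)
    (by
      rintro _ ⟨F, hF, rfl⟩
      exact ⟨_, ⟨F, hF, rfl⟩, fun _ h => star_symm F h⟩)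
    (by
      rintro _ ⟨G, -, rfl⟩
      obtain ⟨F, hFE, hFG⟩ := E.exists_comp G
      refine ⟨_, ⟨F, hFE, rfl⟩, ?_⟩
      rintro ⟨a, c⟩ ⟨b, hab, hbc⟩
      exact star_comp hFE hFG hab hbc)

end ChainSpace

end Chains

section Limit

variable (X : Type*) [UniformSpace X] (x₀ : X)

/-- `X̃`, the inverse limit of the fundamental inverse system `(X_E, φ_{EF})`, with the
inverse limit uniformity (the subspace uniformity of the product). -/
abbrev LimitSpace : Type _ :=
  {u : ∀ E : Entourage X, ChainSpace E x₀ //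
    ∀ (E F : Entourage X) (h : F.carrier ⊆ E.carrier), ChainSpace.bond h (u F) = u E}

variable {X x₀}

/-- The projection `φ_E : X̃ → X_E`. -/
def LimitSpace.proj (E : Entourage X) (u : LimitSpace X x₀) : ChainSpace E x₀ := u.1 E

/-- The endpoint map `φ : X̃ → X`. -/
def LimitSpace.endpoint (u : LimitSpace X x₀) : X :=
  ChainSpace.endpoint Entourage.full x₀ (u.proj Entourage.full)

/-- The endpoint may be read off at any entourage: `φ = φ_{XE} ∘ φ_E`. -/
theorem LimitSpace.endpoint_eq (E : Entourage X) (u : LimitSpace X x₀) :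
    u.endpoint = ChainSpace.endpoint E x₀ (u.proj E) := by
  unfold LimitSpace.endpoint LimitSpace.proj
  rw [← u.2 Entourage.full E (Set.subset_univ _)]
  generalize u.1 E = a
  induction a using Quotient.inductionOn with
  | h α => rfl

end Limit

/-- `E` is a universal entourage (for the basepoint `x₀`): the endpoint map
`φ_{XE} : X_E → X` is a uniform homeomorphism. -/
def IsUniversalEntourage {X : Type*} [UniformSpace X] (x₀ : X) (E : Entourage X) : Prop :=
  ∃ e : ChainSpace E x₀ ≃ᵤ X, ∀ a, e a = ChainSpace.endpoint E x₀ a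

/-- `X` is universal: its uniformity has a basis of universal entourages. -/
def IsUniversal (X : Type*) [UniformSpace X] (x₀ : X) : Prop :=
  ∃ B : Set (Entourage X), (𝓤 X).HasBasis (fun E => E ∈ B) Entourage.carrier ∧
    ∀ E ∈ B, IsUniversalEntourage x₀ E

/-- `X` is coverable: `φ : X̃ → X` is surjective, and `φ_E : X̃ → X_E` is surjective for all `E`
in some basis of the uniformity. -/
def IsCoverable (X : Type*) [UniformSpace X] (x₀ : X) : Prop :=
  Function.Surjective (LimitSpace.endpoint : LimitSpace X x₀ → X) ∧
  ∃ B : Set (Entourage X), (𝓤 X).HasBasis (fun E => E ∈ B) Entourage.carrier ∧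
    ∀ E ∈ B, Function.Surjective (LimitSpace.proj E : LimitSpace X x₀ → ChainSpace E x₀)

/-- `f` is bi-uniformly continuous: the inverse image of any entourage is an entourage, and the
image of any entourage is an entourage in the subspace uniformity of the image of `f`. -/
structure BiUniformlyContinuous {X Y : Type*} [UniformSpace X] [UniformSpace Y]
    (f : X → Y) : Prop where
  preimage_mem : ∀ V ∈ 𝓤 Y, Prod.map f f ⁻¹' V ∈ 𝓤 X
  image_mem : ∀ U ∈ 𝓤 X,
    Prod.map ((↑) : Set.range f → Y) ((↑) : Set.range f → Y) ⁻¹' (Prod.map f f '' U) ∈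
      𝓤 (Set.range f)

end UniformCover

/-! A universal entourage `E` of `X` is "simply connected": any two points are joined by an
`E`-chain, unique up to `E`-homotopy (`IsUniversalEntourage.simplyConnected`). This is free of
basepoints, which is why any basepoint of `Y` is allowed.

Fix `a`, `b` in `X`. For each entourage `H` of `Y`, join `a` to `b` by a chain for a simply
connected entourage inside the inverse image of `H`, and push it forward by `f`. The resulting
chains are compatible up to homotopy as `H` varies, by comparison with a chain for a still finer
simply connected entourage (`IsUniversal.pathHomotopic`). Based at a lift of the basepoint, they
define points of the inverse limit over every endpoint.

The images `f(E)` of simply connected `E` form a basis of `Y`. Each edge of an `f(E)`-chain lifts to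
a pair in `E`; replacing every edge by the compatible family of its lift and concatenating in `Y`
gives a limit point projecting to the class of that chain. -/

namespace UniformCover

/-! ### Free-basepoint chains as lists: concatenation, reversal, homotopy. -/

section Paths

variable {α β : Type*} {R S : α → α → Prop} {a b c : α} {l l' m m' : List α}

/-- `l` is a list of points from `a` to `b` whose consecutive members are related by `R`. -/
structure IsPath (R : α → α → Prop) (a b : α) (l : List α) : Prop where
  isChain : List.IsChain R l
  head : l.head? = some a
  last : l.getLast? = some b

/-- `m` arises from the path `l` by adding one point, the endpoints `a` and `b` being kept. -/
def PathStep (R : α → α → Prop) (a b : α) (l m : List α) : Prop :=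
  IsPath R a b l ∧ IsPath R a b m ∧ ∃ (u v : List α) (x : α), l = u ++ v ∧ m = u ++ x :: v

/-- Homotopy of paths from `a` to `b`, as lists. -/
def PathHomotopic (R : α → α → Prop) (a b : α) : List α → List α → Prop :=
  Relation.EqvGen (PathStep R a b)

theorem IsPath.singleton (a : α) : IsPath R a a [a] :=
  ⟨List.isChain_singleton _, rfl, rfl⟩

theorem IsPath.pair (h : R a b) : IsPath R a b [a, b] :=
  ⟨by simpa using h, rfl, rfl⟩

theorem IsPath.ne_nil (h : IsPath R a b l) : l ≠ [] := by
  rintro rfl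
  simpa using h.head

theorem IsPath.mono (hRS : ∀ x y, R x y → S x y) (h : IsPath R a b l) : IsPath S a b l :=
  ⟨h.isChain.imp hRS, h.head, h.last⟩

theorem IsPath.map {T : β → β → Prop} {f : α → β} (hf : ∀ x y, R x y → T (f x) (f y))
    (h : IsPath R a b l) : IsPath T (f a) (f b) (l.map f) where
  isChain := (List.isChain_map f).2 (h.isChain.imp hf)
  head := by simp [h.head]
  last := by simp [h.last]

/-- The junction is an edge, not a shared point: when `b = b'`, reflexivity supplies it and the
point occurs twice. -/
theorem IsPath.append {b' : α} (hl : IsPath R a b l) (hm : IsPath R b' c m) (h : R b b') :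
    IsPath R a c (l ++ m) where
  isChain := by
    refine List.isChain_append.2 ⟨hl.isChain, hm.isChain, ?_⟩
    intro x hx y hy
    rw [hl.last] at hx
    rw [hm.head] at hy
    cases hx
    cases hy
    exact h
  head := by simp [List.head?_append, hl.head]
  last := by simp [List.getLast?_append, hm.last]

theorem IsPath.reverse (hR : ∀ x y, R x y → R y x) (h : IsPath R a b l) :
    IsPath R b a l.reverse where
  isChain := List.isChain_reverse.2 (h.isChain.imp hR)
  head := by simp [h.last]
  last := by simp [h.head]

theorem PathHomotopic.symm (h : PathHomotopic R a b l m) : PathHomotopic R a b m l :=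
  Relation.EqvGen.symm _ _ h

theorem PathHomotopic.trans {n : List α} (h : PathHomotopic R a b l m)
    (h' : PathHomotopic R a b m n) : PathHomotopic R a b l n :=
  Relation.EqvGen.trans _ _ _ h h'

/-- `PathHomotopic` is reflexive on all lists, so being a path can only be transported along it, not
deduced from it. -/
theorem PathHomotopic.isPath_iff (h : PathHomotopic R a b l m) :
    IsPath R a b l ↔ IsPath R a b m := by
  induction h with
  | rel _ _ h => exact iff_of_true h.1 h.2.1
  | refl _ => rfl
  | symm _ _ _ ih => exact ih.symm
  | trans _ _ _ _ _ ih₁ ih₂ => exact ih₁.trans ih₂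

theorem PathHomotopic.map {T : β → β → Prop} {f : α → β} (hf : ∀ x y, R x y → T (f x) (f y))
    (h : PathHomotopic R a b l m) : PathHomotopic T (f a) (f b) (l.map f) (m.map f) := by
  induction h with
  | rel _ _ h =>
    obtain ⟨h₁, h₂, u, v, x, rfl, rfl⟩ := h
    exact .rel _ _ ⟨h₁.map hf, h₂.map hf, u.map f, v.map f, f x, by simp, by simp⟩
  | refl _ => exact Relation.EqvGen.refl _
  | symm _ _ _ ih => exact ih.symm
  | trans _ _ _ _ _ ih₁ ih₂ => exact ih₁.trans ih₂

theorem PathHomotopic.mono (hRS : ∀ x y, R x y → S x y) (h : PathHomotopic R a b l m) :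
    PathHomotopic S a b l m := by
  simpa using h.map (f := id) hRS

theorem PathHomotopic.append_left {b' : α} (hl : IsPath R a b l) (hb : R b b')
    (h : PathHomotopic R b' c m m') : PathHomotopic R a c (l ++ m) (l ++ m') := by
  induction h with
  | rel _ _ h =>
    obtain ⟨h₁, h₂, u, v, x, rfl, rfl⟩ := h
    exact .rel _ _ ⟨hl.append h₁ hb, hl.append h₂ hb, l ++ u, v, x, by simp, by simp⟩
  | refl _ => exact Relation.EqvGen.refl _
  | symm _ _ _ ih => exact ih.symm
  | trans _ _ _ _ _ ih₁ ih₂ => exact ih₁.trans ih₂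

theorem PathHomotopic.append_right {b' : α} (hm : IsPath R b' c m) (hb : R b b')
    (h : PathHomotopic R a b l l') : PathHomotopic R a c (l ++ m) (l' ++ m) := by
  induction h with
  | rel _ _ h =>
    obtain ⟨h₁, h₂, u, v, x, rfl, rfl⟩ := h
    exact .rel _ _ ⟨h₁.append hm hb, h₂.append hm hb, u, v ++ m, x, by simp, by simp⟩
  | refl _ => exact Relation.EqvGen.refl _
  | symm _ _ _ ih => exact ih.symm
  | trans _ _ _ _ _ ih₁ ih₂ => exact ih₁.trans ih₂

theorem PathHomotopic.append {b' : α} (hl : IsPath R a b l) (hm' : IsPath R b' c m')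
    (hb : R b b') (h : PathHomotopic R a b l l') (h' : PathHomotopic R b' c m m') :
    PathHomotopic R a c (l ++ m) (l' ++ m') :=
  (h'.append_left hl hb).trans (h.append_right hm' hb)

/-- A repetition of the first point may be removed. -/
theorem IsPath.homotopic_cons (hR : ∀ x, R x x) (h : IsPath R a b l) :
    PathHomotopic R a b l (a :: l) :=
  .rel _ _ ⟨h, (IsPath.singleton a).append h (hR a), [], l, a, rfl, rfl⟩

/-- Running along a path backwards and then forwards may be cancelled. -/
theorem IsPath.homotopic_reverse_append (hR : ∀ x, R x x) (hR' : ∀ x y, R x y → R y x)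
    (hm : IsPath R b c m) :
    ∀ {p : List α} {a : α}, IsPath R a b p → PathHomotopic R b c (p.reverse ++ (p ++ m)) m
  | [], _, hp => absurd rfl hp.ne_nil
  | [x], a, hp => by
    obtain rfl : x = b := by simpa using hp.last
    exact ((hm.homotopic_cons hR).trans
      (((IsPath.singleton x).append hm (hR x)).homotopic_cons hR)).symm
  | x :: y :: q, a, hp => by
    have hxy : R x y := (List.isChain_cons_cons.1 hp.isChain).1
    have hq : IsPath R y b (y :: q) :=
      ⟨(List.isChain_cons_cons.1 hp.isChain).2, rfl, by simpa using hp.last⟩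
    have hr := hq.reverse hR'
    have hqm := hq.append hm (hR b)
    have hx := (IsPath.singleton (R := R) x).append hqm hxy
    have h₁ : IsPath R b c ((y :: q).reverse ++ (x :: (y :: q ++ m))) := hr.append hx (hR' _ _ hxy)
    have h₂ : IsPath R b c ((y :: q).reverse ++ (x :: x :: (y :: q ++ m))) :=
      hr.append ((IsPath.singleton x).append hx (hR x)) (hR' _ _ hxy)
    have e : (x :: y :: q).reverse ++ ((x :: y :: q) ++ m) =
        (y :: q).reverse ++ (x :: x :: (y :: q ++ m)) := by simp
    rw [e]
    -- At the turning point the list reads `y, x, x, y`. Delete one `x`, then the other; the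
    -- remaining `y, y` is allowed by reflexivity.
    refine PathHomotopic.trans (.symm (.rel _ _ ⟨h₁, h₂, _, _, x, rfl, rfl⟩)) ?_
    refine PathHomotopic.trans (.symm (.rel _ _
      ⟨hr.append hqm (hR y), h₁, _, _, x, rfl, rfl⟩)) ?_
    exact homotopic_reverse_append hR hR' hm hq

end Paths

/-! ### Simply connected entourages and compatible families of chains. -/

section Chains

variable {X : Type*} [UniformSpace X] {E F : Entourage X} {x₀ : X}

/-- Membership in an entourage as a relation. -/
def Entourage.Rel (E : Entourage X) (x y : X) : Prop := (x, y) ∈ E.carrier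

theorem Chain.isPath (γ : Chain E x₀) : IsPath E.Rel x₀ γ.endpoint γ.points :=
  ⟨γ.isChain, rfl, List.getLast?_eq_getLast_of_ne_nil _⟩

/-- A path starting at `x₀` as a chain. -/
def IsPath.toChain {x : X} {l : List X} (h : IsPath E.Rel x₀ x l) : Chain E x₀ where
  tail := l.tail
  isChain := by
    rw [List.cons_head?_tail (by rw [h.head]; rfl)]
    exact h.isChain

theorem IsPath.points_toChain {x : X} {l : List X} (h : IsPath E.Rel x₀ x l) :
    h.toChain.points = l :=
  List.cons_head?_tail (by rw [h.head]; rfl)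

theorem IsPath.endpoint_toChain {x : X} {l : List X} (h : IsPath E.Rel x₀ x l) :
    h.toChain.endpoint = x := by
  have := h.toChain.isPath.last
  rw [h.points_toChain, h.last] at this
  exact (Option.some.inj this).symm

theorem Chain.ext_points {γ δ : Chain E x₀} (h : γ.points = δ.points) : γ = δ := by
  cases γ
  cases δ
  simpa [Chain.points] using h

theorem Chain.Homotopic.pathHomotopic {γ δ : Chain E x₀} (h : Chain.Homotopic γ δ) :
    PathHomotopic E.Rel x₀ γ.endpoint γ.points δ.points := by
  induction h with
  | rel γ δ h => exact .rel _ _ ⟨γ.isPath, h.2 ▸ δ.isPath, h.1⟩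
  | refl _ => exact Relation.EqvGen.refl _
  | symm γ δ h ih => exact (Chain.Homotopic.endpoint_eq h ▸ ih).symm
  | trans γ δ ε h _ ih₁ ih₂ => exact ih₁.trans (Chain.Homotopic.endpoint_eq h ▸ ih₂)

theorem PathHomotopic.homotopic_toChain {x : X} {l m : List X}
    (h : PathHomotopic E.Rel x₀ x l m) (hl : IsPath E.Rel x₀ x l) (hm : IsPath E.Rel x₀ x m) :
    Chain.Homotopic hl.toChain hm.toChain := by
  induction h with
  | rel l m h =>
    refine .rel _ _ ⟨?_, by rw [hl.endpoint_toChain, hm.endpoint_toChain]⟩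
    rw [hl.points_toChain, hm.points_toChain]
    exact h.2.2
  | refl _ => exact Relation.EqvGen.refl _
  | symm _ _ _ ih => exact .symm _ _ (ih hm hl)
  | trans l n m h _ ih₁ ih₂ =>
    have hn := (PathHomotopic.isPath_iff h).1 hl
    exact .trans _ _ _ (ih₁ hl hn) (ih₂ hn hm)

/-- All points are joined by `E`-chains, and any two `E`-chains with common endpoints are
`E`-homotopic. -/
structure Entourage.SimplyConnected (E : Entourage X) : Prop where
  exists_path : ∀ a b, ∃ l, IsPath E.Rel a b l
  homotopic : ∀ a b l m, IsPath E.Rel a b l → IsPath E.Rel a b m → PathHomotopic E.Rel a b l m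

theorem IsUniversalEntourage.simplyConnected (h : IsUniversalEntourage x₀ E) :
    E.SimplyConnected := by
  obtain ⟨e, he⟩ := h
  have hsymm : ∀ x y, E.Rel x y → E.Rel y x := fun _ _ => E.symm
  have hpath : ∀ a, ∃ l, IsPath E.Rel x₀ a l := by
    intro a
    obtain ⟨q, hq⟩ := e.surjective a
    induction q using Quotient.inductionOn with
    | h γ =>
      obtain rfl : γ.endpoint = a := (he _).symm.trans hq
      exact ⟨_, γ.isPath⟩
  have hbased : ∀ a l m, IsPath E.Rel x₀ a l → IsPath E.Rel x₀ a m →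
      PathHomotopic E.Rel x₀ a l m := by
    intro a l m hl hm
    have key : ChainSpace.mk hl.toChain = ChainSpace.mk hm.toChain := by
      apply e.injective
      rw [he, he]
      exact hl.endpoint_toChain.trans hm.endpoint_toChain.symm
    have := (ChainSpace.mk_eq.1 key).pathHomotopic
    rwa [hl.points_toChain, hm.points_toChain, hl.endpoint_toChain] at this
  refine ⟨fun a b => ?_, fun a b l m hl hm => ?_⟩
  · obtain ⟨p, hp⟩ := hpath a
    obtain ⟨q, hq⟩ := hpath b
    exact ⟨_, (hp.reverse hsymm).append hq (E.refl x₀)⟩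
  -- Reduction to the based case: prefix both paths by `p` from `x₀` to `a`, then cancel `p` by
  -- prepending its reverse.
  · obtain ⟨p, hp⟩ := hpath a
    have h := hbased b _ _ (hp.append hl (E.refl a)) (hp.append hm (E.refl a))
    exact (hl.homotopic_reverse_append E.refl hsymm hp).symm.trans
      ((h.append_left (hp.reverse hsymm) (E.refl x₀)).trans
        (hm.homotopic_reverse_append E.refl hsymm hp))

theorem IsUniversal.exists_simplyConnected (hX : IsUniversal X x₀) {U : Set (X × X)}
    (hU : U ∈ 𝓤 X) : ∃ F : Entourage X, F.SimplyConnected ∧ F.carrier ⊆ U := by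
  obtain ⟨B, hB, hB'⟩ := hX
  obtain ⟨F, hF, hFU⟩ := hB.mem_iff.1 hU
  exact ⟨F, (hB' F hF).simplyConnected, hFU⟩

/-- Chains for different universal entourages inside `D` become homotopic in `D`. -/
theorem IsUniversal.pathHomotopic (hX : IsUniversal X x₀) {D F F' : Entourage X} {a b : X}
    {l l' : List X} (hF : F.SimplyConnected) (hF' : F'.SimplyConnected)
    (hFD : F.carrier ⊆ D.carrier) (hFD' : F'.carrier ⊆ D.carrier)
    (hl : IsPath F.Rel a b l) (hl' : IsPath F'.Rel a b l') : PathHomotopic D.Rel a b l l' := by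
  -- A `K`-path is both an `F`-path and an `F'`-path, hence homotopic to `l` in `F` and to `l'` in
  -- `F'`; both homotopies live in `D`.
  obtain ⟨K, hK, hKF⟩ := hX.exists_simplyConnected (F.inter F').mem_uniformity
  obtain ⟨m, hm⟩ := hK.exists_path a b
  have h₁ := hF.homotopic a b l m hl (hm.mono fun _ _ h => (hKF h).1)
  have h₂ := hF'.homotopic a b m l' (hm.mono fun _ _ h => (hKF h).2) hl'
  exact (h₁.mono fun _ _ h => hFD h).trans (h₂.mono fun _ _ h => hFD' h)

/-- A compatible family of paths, one for each entourage. -/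
structure IsCompatible (a b : X) (p : Entourage X → List X) : Prop where
  isPath : ∀ E, IsPath E.Rel a b (p E)
  homotopic : ∀ E F : Entourage X, F.carrier ⊆ E.carrier →
    PathHomotopic E.Rel a b (p F) (p E)

theorem IsCompatible.append {a b c : X} {p q : Entourage X → List X} (hp : IsCompatible a b p)
    (hq : IsCompatible b c q) : IsCompatible a c (fun E => p E ++ q E) where
  isPath E := (hp.isPath E).append (hq.isPath E) (E.refl b)
  homotopic E F h := (hp.homotopic E F h).append ((hp.isPath F).mono fun _ _ h' => h h')
    (hq.isPath E) (E.refl b) (hq.homotopic E F h)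

theorem IsCompatible.exists_limit {b : X} {p : Entourage X → List X}
    (hp : IsCompatible x₀ b p) :
    ∃ u : LimitSpace X x₀, ∀ E, u.proj E = ChainSpace.mk (hp.isPath E).toChain := by
  refine ⟨⟨fun E => ChainSpace.mk (hp.isPath E).toChain, fun E F h => ?_⟩, fun E => rfl⟩
  exact ChainSpace.mk_eq.2 ((hp.homotopic E F h).homotopic_toChain
    ((hp.isPath F).mono fun _ _ h' => h h') (hp.isPath E))

/-- Criterion for surjectivity of the projection to `X_E`: it suffices to deform each chain into the
`E`-member of a compatible family. -/
theorem exists_limit_of_isCompatible (γ : Chain E x₀) {p : Entourage X → List X}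
    (hp : IsCompatible x₀ γ.endpoint p)
    (h : PathHomotopic E.Rel x₀ γ.endpoint (p E) γ.points) :
    ∃ u : LimitSpace X x₀, u.proj E = ChainSpace.mk γ := by
  obtain ⟨u, hu⟩ := hp.exists_limit
  refine ⟨u, (hu E).trans (ChainSpace.mk_eq.2 ?_)⟩
  have := h.homotopic_toChain (hp.isPath E) γ.isPath
  rwa [Chain.ext_points γ.isPath.points_toChain] at this

end Chains

/-! ### Transporting entourages and chains along `f`. -/

section Images

variable {X Y : Type*} [UniformSpace X] [UniformSpace Y] {x₀ : X} {f : X → Y}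

/-- The inverse image of an entourage. -/
def BiUniformlyContinuous.comap (hf : BiUniformlyContinuous f) (H : Entourage Y) :
    Entourage X where
  carrier := Prod.map f f ⁻¹' H.carrier
  mem_uniformity := hf.preimage_mem _ H.mem_uniformity
  symm := fun h => H.symm h

/-- The image of an entourage under a surjection. -/
def BiUniformlyContinuous.map (hf : BiUniformlyContinuous f) (hsurj : Function.Surjective f)
    (E : Entourage X) : Entourage Y where
  carrier := Prod.map f f '' E.carrier
  mem_uniformity := by
    have h := hf.image_mem _ E.mem_uniformity
    rw [uniformity_subtype, Filter.mem_comap] at h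
    obtain ⟨V, hV, hVE⟩ := h
    refine Filter.mem_of_superset hV ?_
    rintro ⟨y, z⟩ hyz
    -- By surjectivity every pair in `V` lies over the range, so the subspace condition holds on all
    -- of `Y`.
    exact hVE (a := (⟨y, hsurj y⟩, ⟨z, hsurj z⟩)) hyz
  symm := by
    rintro _ _ ⟨⟨a, b⟩, hab, h⟩
    cases h
    exact ⟨(b, a), E.symm hab, rfl⟩

/-- The images of two points of a universal space are joined by a compatible family of paths,
which is homotopic to any given chain of a universal entourage. -/
theorem IsUniversal.exists_isCompatible (hX : IsUniversal X x₀) (hf : BiUniformlyContinuous f)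
    (a b : X) : ∃ p : Entourage Y → List Y, IsCompatible (f a) (f b) p ∧
      ∀ (E : Entourage X) (G : Entourage Y) (l : List X), E.SimplyConnected →
        E.carrier ⊆ (hf.comap G).carrier → IsPath E.Rel a b l →
        PathHomotopic G.Rel (f a) (f b) (p G) (l.map f) := by
  choose F hF hFH using fun H : Entourage Y =>
    hX.exists_simplyConnected (hf.comap H).mem_uniformity
  choose q hq using fun H => (hF H).exists_path a b
  refine ⟨fun H => (q H).map f, ⟨fun H => (hq H).map fun _ _ h => hFH H h, ?_⟩, ?_⟩
  · intro H K hKH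
    -- The chosen `F K` and `F H` need not be nested, but both lie in the inverse image of `H`.
    exact (hX.pathHomotopic (D := hf.comap H) (hF K) (hF H) (fun _ h => hKH (hFH K h)) (hFH H)
      (hq K) (hq H)).map fun _ _ h => h
  · intro E G l hE hEG hl
    exact (hX.pathHomotopic (hF G) hE (hFH G) hEG (hq G) hl).map fun _ _ h => h

/-- Induction on the chain, lifting one edge at a time. Lifts of consecutive edges need not meet in
`X`; only their images are concatenated. -/
theorem IsUniversal.exists_isCompatible_homotopic (hX : IsUniversal X x₀)
    (hf : BiUniformlyContinuous f) (hsurj : Function.Surjective f) {E : Entourage X}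
    (hE : E.SimplyConnected) {z : Y} :
    ∀ {l : List Y} {y : Y}, IsPath (hf.map hsurj E).Rel y z l →
      ∃ p : Entourage Y → List Y, IsCompatible y z p ∧
        PathHomotopic (hf.map hsurj E).Rel y z (p (hf.map hsurj E)) l
  | [], _, hl => absurd rfl hl.ne_nil
  | [x], y, hl => by
    obtain rfl : x = y := by simpa using hl.head
    obtain rfl : x = z := by simpa using hl.last
    exact ⟨fun _ => [x], ⟨fun _ => .singleton x, fun _ _ _ => Relation.EqvGen.refl _⟩,
      Relation.EqvGen.refl _⟩
  | x :: w :: l, y, hl => by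
    obtain rfl : x = y := by simpa using hl.head
    obtain ⟨⟨⟨a, b⟩, hab, hxw⟩, hwl⟩ := List.isChain_cons_cons.1 hl.isChain
    obtain ⟨rfl, rfl⟩ : f a = x ∧ f b = w := by simpa using hxw
    have hw : IsPath (hf.map hsurj E).Rel (f b) z (f b :: l) :=
      ⟨hwl, rfl, by simpa using hl.last⟩
    obtain ⟨q, hq, hql⟩ := exists_isCompatible_homotopic hX hf hsurj hE hw
    obtain ⟨p, hp, hpE⟩ := hX.exists_isCompatible hf a b
    -- Since `E` lies in the inverse image of its own image, the edge `[a, b]` itself serves as the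
    -- comparison chain.
    have hpab := hpE E (hf.map hsurj E) [a, b] hE (fun x hx => ⟨x, hx, rfl⟩) (.pair hab)
    refine ⟨_, hp.append hq, (hpab.append (hp.isPath _) hw (Entourage.refl _ _) hql).trans ?_⟩
    -- Concatenation has produced `f a, f b, f b, …`; the repeated `f b` is deleted.
    exact ((hw.homotopic_cons (Entourage.refl _)).append_left (.singleton (f a))
      ⟨(a, b), hab, rfl⟩).symm

end Images

end UniformCover

theorem mainTheorem3 {X Y : Type*} [UniformSpace X] [UniformSpace Y] (x₀ : X) (y₀ : Y)
    (f : X → Y) (hf : UniformCover.BiUniformlyContinuous f) (hsurj : Function.Surjective f)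
    (hX : UniformCover.IsUniversal X x₀) :
    UniformCover.IsCoverable Y y₀ := by
  open UniformCover in
  refine ⟨fun y => ?_, {G | ∃ E : Entourage X, E.SimplyConnected ∧ G = hf.map hsurj E}, ⟨?_⟩, ?_⟩
  -- The starting point is any lift of `y₀`, unrelated to `x₀`.
  · obtain ⟨a, rfl⟩ := hsurj y₀
    obtain ⟨b, rfl⟩ := hsurj y
    obtain ⟨p, hp, -⟩ := hX.exists_isCompatible hf a b
    obtain ⟨u, hu⟩ := hp.exists_limit
    refine ⟨u, ?_⟩
    rw [LimitSpace.endpoint, hu]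
    exact (hp.isPath _).endpoint_toChain
  · intro V
    constructor
    · intro hV
      -- Images of simply connected entourages are arbitrarily small: if `E` lies in the inverse
      -- image of `V`, its image lies in `V`.
      obtain ⟨E, hE, hEV⟩ := hX.exists_simplyConnected (hf.preimage_mem V hV)
      exact ⟨_, ⟨E, hE, rfl⟩, Set.image_subset_iff.2 hEV⟩
    · rintro ⟨G, -, hGV⟩
      exact Filter.mem_of_superset G.mem_uniformity hGV
  · rintro _ ⟨E, hE, rfl⟩ q
    induction q using Quotient.inductionOn with
    | h γ =>
      obtain ⟨p, hp, h⟩ := hX.exists_isCompatible_homotopic hf hsurj hE γ.isPath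
      exact exists_limit_of_isCompatible γ hp h
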